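/- All Banach spaces are real. Let $Z$ be a Banach space. A linear subspace $Y\subset Z^*$ is called *norming* if $|||z|||:=\sup\{z^*(z): z^*\in Y,\ \|z^*\|\le 1\}$ defines an equivalent norm on $Z$. For a norming subspace $Y\subset Z^*$, let $\mu(Z,Y)$ denote the Mackey topology on $Z$ associated to the dual pair $\langle Z,Y\rangle$, i.e. the locally convex topology of uniform convergence on all absolutely convex $w^*$-compact subsets of $Z^*$ contained in $Y$. The space $Z$ is called *fully Mackey complete* if the locally convex space $(Z,\mu(Z,Y))$ is complete for every norming and norm-closed subspace $Y\subset Z^*$. Theorem. Let $X$ be a Banach space. If the dual space $X^*$ is fully Mackey complete, then $X$ is $w^*$-sequentially dense in $X^{**}$; that is, for every $x^{**}\in X^{**}$ there is a sequence $(x_n)_{n\in\mathbb N}$ in $X$ (canonically embedded in $X^{**}$) which converges to $x^{**}$ in the $w^*$-topology of $X^{**}$. -/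

import Mathlib

namespace FullyMackey

open scoped UniformConvergence

variable {X : Type*} [NormedAddCommGroup X] [NormedSpace ℝ X]

/-- The functional `|||x||| = sup {x*(x) : x* ∈ Y, ‖x*‖ ≤ 1}` on `X` attached to a subspace `Y` of
the dual `X*`. -/
noncomputable def supNorm (Y : Submodule ℝ (StrongDual ℝ X)) (x : X) : ℝ :=
  sSup {r : ℝ | ∃ f ∈ Y, ‖f‖ ≤ 1 ∧ f x = r}

/-- A subspace `Y ⊆ X*` is norming if `|||·|||` is an equivalent norm on `X`. As a supremum of
functionals over a nonempty symmetric bounded set, `|||·|||` is always a seminorm (see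
`supNormSeminorm` below), so only the two-sided comparison with `‖·‖` has to be required. -/
def IsNorming (Y : Submodule ℝ (StrongDual ℝ X)) : Prop :=
  ∃ c > 0, ∃ C > 0, ∀ x : X, c * ‖x‖ ≤ supNorm Y x ∧ supNorm Y x ≤ C * ‖x‖

/-- The family of all absolutely convex `w*`-compact subsets of `X*` contained in `Y`. -/
def absConvexWeakStarCompacts (Y : Submodule ℝ (StrongDual ℝ X)) : Set (Set (StrongDual ℝ X)) :=
  {K | K ⊆ Y ∧ AbsConvex ℝ K ∧ IsCompact (StrongDual.toWeakDual '' K : Set (WeakDual ℝ X))}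

/-- The uniformity on `X` of uniform convergence on all absolutely convex `w*`-compact subsets
of `Y`, where `x : X` acts on `X*` by evaluation. -/
noncomputable abbrev mackeyUniformSpace (Y : Submodule ℝ (StrongDual ℝ X)) : UniformSpace X :=
  UniformSpace.comap
    (fun x : X => UniformOnFun.ofFun (absConvexWeakStarCompacts Y)
      (fun f : StrongDual ℝ X => f x))
    (inferInstance : UniformSpace (StrongDual ℝ X →ᵤ[absConvexWeakStarCompacts Y] ℝ))

/-- The Mackey topology `μ(X, Y)`. -/
noncomputable abbrev mackeyTopology (Y : Submodule ℝ (StrongDual ℝ X)) : TopologicalSpace X :=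
  (mackeyUniformSpace Y).toTopologicalSpace

/-- `μ(X, Y)` is compatible with addition, and `mackeyUniformSpace Y` is its translation-invariant
uniformity, so that completeness for it is completeness of `(X, μ(X, Y))` as a locally convex
space. -/
theorem isUniformAddGroup_mackey (Y : Submodule ℝ (StrongDual ℝ X)) :
    @IsUniformAddGroup X (mackeyUniformSpace Y) _ := by
  let φ : X →+ (StrongDual ℝ X →ᵤ[absConvexWeakStarCompacts Y] ℝ) :=
    { toFun := fun x => UniformOnFun.ofFun _ (fun f : StrongDual ℝ X => f x)
      map_zero' := funext fun f => map_zero f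
      map_add' := fun x y => funext fun f => map_add f x y }
  exact IsUniformAddGroup.comap φ

/-- `(X, μ(X, Y))` is complete. -/
def MackeyComplete (Y : Submodule ℝ (StrongDual ℝ X)) : Prop :=
  @CompleteSpace X (mackeyUniformSpace Y)

variable (X) in
/-- `X` is fully Mackey complete: `(X, μ(X, Y))` is complete for every norming and norm-closed
subspace `Y ⊆ X*`. -/
def FullyMackeyComplete : Prop :=
  ∀ Y : Submodule ℝ (StrongDual ℝ X),
    IsNorming Y → IsClosed (Y : Set (StrongDual ℝ X)) → MackeyComplete Y

variable (X) in
/-- `X` is `w*`-sequentially dense in `X**`: every `x** ∈ X**` is the `w*`-limit of a sequence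
of elements of (the canonical image of) `X`. -/
def WeakStarSeqDenseInBidual : Prop :=
  seqClosure (Set.range fun x : X =>
      StrongDual.toWeakDual (NormedSpace.inclusionInDoubleDual ℝ X x) :
    Set (WeakDual ℝ (StrongDual ℝ X))) = Set.univ

theorem bddAbove_supNorm (Y : Submodule ℝ (StrongDual ℝ X)) (x : X) :
    BddAbove {r : ℝ | ∃ f ∈ Y, ‖f‖ ≤ 1 ∧ f x = r} := by
  refine ⟨‖x‖, ?_⟩
  rintro r ⟨f, -, hf, rfl⟩
  have h := f.le_of_opNorm_le hf x
  rw [one_mul] at h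
  exact (le_abs_self _).trans h

theorem supNorm_neg (Y : Submodule ℝ (StrongDual ℝ X)) (x : X) : supNorm Y (-x) = supNorm Y x := by
  unfold supNorm
  congr 1
  ext r
  constructor
  · rintro ⟨f, hf, h1, rfl⟩
    exact ⟨-f, Y.neg_mem hf, by rwa [norm_neg], by simp⟩
  · rintro ⟨f, hf, h1, rfl⟩
    exact ⟨-f, Y.neg_mem hf, by rwa [norm_neg], by simp⟩

/-- `|||·|||` as a seminorm. -/
noncomputable def supNormSeminorm (Y : Submodule ℝ (StrongDual ℝ X)) : Seminorm ℝ X :=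
  have hadd : ∀ x y, supNorm Y (x + y) ≤ supNorm Y x + supNorm Y y := by
    intro x y
    refine csSup_le ⟨0, 0, Y.zero_mem, by simp, by simp⟩ ?_
    rintro r ⟨f, hf, h1, rfl⟩
    rw [map_add]
    exact add_le_add (le_csSup (bddAbove_supNorm Y x) ⟨f, hf, h1, rfl⟩)
      (le_csSup (bddAbove_supNorm Y y) ⟨f, hf, h1, rfl⟩)
  have hnn : ∀ x, 0 ≤ supNorm Y x := fun x =>
    le_csSup (bddAbove_supNorm Y x) ⟨0, Y.zero_mem, by simp, by simp⟩
  have hpos : ∀ (a : ℝ) (x : X), 0 ≤ a → supNorm Y (a • x) ≤ a * supNorm Y x := by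
    intro a x ha
    refine csSup_le ⟨0, 0, Y.zero_mem, by simp, by simp⟩ ?_
    rintro r ⟨f, hf, h1, rfl⟩
    rw [map_smul, smul_eq_mul]
    exact mul_le_mul_of_nonneg_left (le_csSup (bddAbove_supNorm Y x) ⟨f, hf, h1, rfl⟩) ha
  Seminorm.ofSMulLE (supNorm Y)
    (le_antisymm (by simpa using hpos 0 0 le_rfl) (hnn 0)) hadd (by
      intro a x
      rcases le_total 0 a with ha | ha
      · rw [Real.norm_of_nonneg ha]
        exact hpos a x ha
      · rw [Real.norm_of_nonpos ha, ← supNorm_neg, ← neg_smul]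
        exact hpos (-a) x (neg_nonneg.2 ha))

end FullyMackey

open scoped UniformConvergence Pointwise

namespace FullyMackey

open Filter Topology Set TopologicalSpace NormedSpace

/-! ### Countable closing-off and `w*`-compact sets in separable subspaces. -/

section General

/-! Suppose ξ ∈ X** is not the w*-limit of a sequence from X. Then Y = X ⊕ ℝξ is norm closed and
norming for X*; let φ ∈ X*** vanish on X with φ(ξ) = 1. The crux is that φ is w*-continuous on
w*-compact subsets of Y (`continuousOn_of_notMem_seqClosure`). Hahn–Banach then approximates φ
uniformly by elements of X* on each absolutely convex one (`exists_eval_approx`), and Mackey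
completeness yields f ∈ X* equal to φ on Y (`MackeyComplete.exists_eval`). So f vanishes on X, hence
f = 0, against φ(ξ) = 1.

Continuity reduces to `exists_eq_inclusion_of_mem_closure`. If that failed, Whitley's construction
(`exists_seq_tendsto_on_separating`) would give a sequence in X whose w*-closure is metrizable and
whose cluster points all lie outside X; a convergent subsequence would then make ξ a sequential
limit. -/

theorem exists_countable_closed_under {α : Type*} (g : Set α → Set α)
    (hg : ∀ F : Set α, F.Finite → (g F).Countable) (z : α) :
    ∃ S : Set α, S.Countable ∧ z ∈ S ∧ ∀ F ⊆ S, F.Finite → g F ⊆ S := by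
  let T : ℕ → Set α := fun n =>
    Nat.rec {z} (fun _ S => S ∪ ⋃ F ∈ {F : Set α | F.Finite ∧ F ⊆ S}, g F) n
  have hT : ∀ n, T (n + 1) = T n ∪ ⋃ F ∈ {F : Set α | F.Finite ∧ F ⊆ T n}, g F := fun _ => rfl
  have hmono : Monotone T := monotone_nat_of_le_succ fun n => by
    rw [hT]; exact subset_union_left
  have hcount : ∀ n, (T n).Countable := by
    intro n
    induction n with
    | zero => exact countable_singleton z
    | succ n ih =>
      rw [hT]
      exact ih.union ((countable_ofPred_finite_subset ih).biUnion fun F hF => hg F hF.1)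
  -- A finite subset of the increasing union already lies in one stage `T n`.
  refine ⟨⋃ n, T n, countable_iUnion hcount, mem_iUnion.2 ⟨0, rfl⟩, fun F hF hfin => ?_⟩
  obtain ⟨n, hn⟩ := DirectedOn.exists_mem_subset_of_finite_of_subset_sUnion
    (c := range T) (range_nonempty T) hmono.directed_le.directedOn_range hfin
    (by rwa [sUnion_range])
  obtain ⟨⟨n, rfl⟩, hn⟩ := hn
  refine Subset.trans ?_ (subset_iUnion T (n + 1))
  rw [hT]
  exact subset_union_of_subset_right
    (subset_biUnion_of_mem (u := fun F => g F)
      (show F ∈ {F : Set α | F.Finite ∧ F ⊆ T n} from ⟨hfin, hn⟩)) _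

theorem exists_submodule_eq_closure {E : Type*} [NormedAddCommGroup E] [NormedSpace ℝ E]
    {S : Set E} (h0 : S.Nonempty) (hadd : ∀ x ∈ S, ∀ y ∈ S, x + y ∈ S)
    (hsmul : ∀ q : ℚ, ∀ x ∈ S, (q : ℝ) • x ∈ S) :
    ∃ M : Submodule ℝ E, (M : Set E) = closure S := by
  refine ⟨{ carrier := closure S, add_mem' := ?_, zero_mem' := ?_, smul_mem' := ?_ }, rfl⟩
  · exact fun hx hy => map_mem_closure₂ continuous_add hx hy hadd
  · obtain ⟨x, hx⟩ := h0
    exact subset_closure (by simpa using hsmul 0 x hx)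
  · intro r x hx
    refine map_mem_closure₂ (s := range ((↑) : ℚ → ℝ)) continuous_smul ?_ hx ?_
    · rw [Rat.denseRange_cast.closure_range]; trivial
    · rintro _ ⟨q, rfl⟩ y hy
      exact hsmul q y hy

variable {V : Type*} [NormedAddCommGroup V] [NormedSpace ℝ V]

theorem exists_half_norming (w : StrongDual ℝ V) : ∃ v : V, ‖v‖ ≤ 1 ∧ ‖w‖ / 2 ≤ w v := by
  rcases (norm_nonneg w).eq_or_lt with h | h
  · exact ⟨0, by simp, by simp [← h]⟩
  · obtain ⟨v, hv, hw⟩ := w.exists_lt_apply_of_lt_opNorm (half_lt_self h)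
    rcases le_total 0 (w v) with h0 | h0
    · exact ⟨v, hv.le, by rw [Real.norm_of_nonneg h0] at hw; exact hw.le⟩
    · exact ⟨-v, by rw [norm_neg]; exact hv.le, by
        rw [Real.norm_of_nonpos h0] at hw; rw [map_neg]; exact hw.le⟩

/-- If s ∈ S is within δ of w, then s(f s) = (s - w)(f s) ≤ δ, so ‖w‖ ≤ ‖s‖ + δ ≤ 2 s(f s) + δ ≤ 3δ;
hence the ε / 3. -/
theorem eq_zero_of_mem_closure_of_half_norming {f : StrongDual ℝ V → V}
    (hf : ∀ w, ‖f w‖ ≤ 1 ∧ ‖w‖ / 2 ≤ w (f w)) {S : Set (StrongDual ℝ V)} {w : StrongDual ℝ V}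
    (hw : w ∈ closure S) (h : ∀ s ∈ S, w (f s) = 0) : w = 0 := by
  rw [← norm_le_zero_iff]
  refine le_of_forall_pos_le_add fun ε hε => ?_
  obtain ⟨s, hs, hd⟩ := Metric.mem_closure_iff.1 hw (ε / 3) (by positivity)
  rw [dist_eq_norm, norm_sub_rev] at hd
  have h1 : s (f s) ≤ ‖s - w‖ := by
    have h2 := (s - w).le_of_opNorm_le_of_le le_rfl (hf s).1
    rw [_root_.sub_apply, h s hs, sub_zero, mul_one] at h2
    exact (le_abs_self _).trans h2
  have h3 := norm_sub_norm_le w (w - s)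
  rw [sub_sub_cancel, norm_sub_rev w s] at h3
  linarith [(hf s).2]

theorem WeakDual.exists_mem_forall_abs_sub_lt {A : Set (WeakDual ℝ V)} {z : WeakDual ℝ V}
    (hz : z ∈ closure A) {F : Set V} (hF : F.Finite) {ε : ℝ} (hε : 0 < ε) :
    ∃ a ∈ A, ∀ v ∈ F, |a v - z v| < ε := by
  have hU : (⋂ v ∈ F, {a : WeakDual ℝ V | |a v - z v| < ε}) ∈ 𝓝 z := by
    rw [biInter_mem hF]
    intro v _
    have : Continuous fun a : WeakDual ℝ V => |a v - z v| :=
      ((WeakDual.eval_continuous v).sub continuous_const).abs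
    exact (isOpen_lt this continuous_const).mem_nhds (by simpa using hε)
  obtain ⟨a, ha, haA⟩ := mem_closure_iff_nhds.1 hz _ hU
  exact ⟨a, haA, fun v hv => mem_iInter₂.1 ha v hv⟩

/-- Whitley's construction: a point of the `w*`-closure of `A` is approached by a sequence of `A`
on a set of vectors which separates the points of a closed separable subspace containing both the
point and the sequence. -/
theorem exists_seq_tendsto_on_separating {A : Set (WeakDual ℝ V)} {z : WeakDual ℝ V}
    (hz : z ∈ closure A) :
    ∃ (M : Submodule ℝ (StrongDual ℝ V)) (D : Set V) (a : ℕ → WeakDual ℝ V),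
      IsClosed (M : Set (StrongDual ℝ V)) ∧ IsSeparable (M : Set (StrongDual ℝ V)) ∧
      WeakDual.toStrongDual z ∈ M ∧ (∀ w ∈ M, (∀ d ∈ D, w d = 0) → w = 0) ∧
      (∀ n, a n ∈ A ∧ WeakDual.toStrongDual (a n) ∈ M) ∧
      ∀ d ∈ D, Tendsto (fun n => a n d) atTop (𝓝 (z d)) := by
  choose f hf using exists_half_norming (V := V)
  have hp : ∀ (F : Set V) (n : ℕ), ∃ a : WeakDual ℝ V, F.Finite →
      a ∈ A ∧ ∀ v ∈ F, |a v - z v| < 1 / ((n : ℝ) + 1) := by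
    intro F n
    by_cases hF : F.Finite
    · obtain ⟨a, ha, h⟩ := WeakDual.exists_mem_forall_abs_sub_lt hz hF
        (ε := 1 / ((n : ℝ) + 1)) (by positivity)
      exact ⟨a, fun _ => ⟨ha, h⟩⟩
    · exact ⟨0, fun h => absurd h hF⟩
  choose p hp using hp
  -- Closing under sums and rational multiples makes the norm closure a real subspace; the last term
  -- adds points of `A` approximating `z` on the half-norming vectors of `F`.
  let g : Set (StrongDual ℝ V) → Set (StrongDual ℝ V) := fun F =>
    (image2 (· + ·) F F ∪ ⋃ q : ℚ, (fun x => (q : ℝ) • x) '' F) ∪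
      range fun n => WeakDual.toStrongDual (p (f '' F) n)
  obtain ⟨S, hSc, hzS, hS⟩ := exists_countable_closed_under g (fun F hF =>
    ((hF.countable.image2 hF.countable _).union
      (countable_iUnion fun q => hF.countable.image _)).union (countable_range _))
    (WeakDual.toStrongDual z)
  obtain ⟨M, hM⟩ := exists_submodule_eq_closure ⟨_, hzS⟩ (S := S)
    (fun x hx y hy => hS {x, y} (insert_subset hx (singleton_subset_iff.2 hy)) (toFinite _)
      (Or.inl (Or.inl ⟨x, by simp, y, by simp, rfl⟩)))
    (fun q x hx => hS {x} (singleton_subset_iff.2 hx) (toFinite _)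
      (Or.inl (Or.inr (mem_iUnion.2 ⟨q, x, rfl, rfl⟩))))
  obtain ⟨e, he⟩ := hSc.exists_eq_range ⟨_, hzS⟩
  have hfin : ∀ n, (e '' Iic n).Finite := fun n => (finite_Iic n).image e
  -- The n-th term approximates `z` at `f (e 0), …, f (e n)`, so each fixed vector is controlled
  -- from some index on.
  refine ⟨M, f '' S, fun n => p (f '' (e '' Iic n)) n, hM ▸ isClosed_closure,
    hM ▸ hSc.isSeparable.closure, ?_, ?_, fun n => ⟨(hp _ n ((hfin n).image f)).1, ?_⟩, ?_⟩
  · rw [← SetLike.mem_coe, hM]; exact subset_closure hzS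
  · intro w hw h
    rw [← SetLike.mem_coe, hM] at hw
    exact eq_zero_of_mem_closure_of_half_norming hf hw fun s hs => h _ (mem_image_of_mem f hs)
  · rw [← SetLike.mem_coe, hM]
    refine subset_closure (hS (e '' Iic n) ?_ (hfin n) (Or.inr ⟨n, rfl⟩))
    rw [he]; exact image_subset_range _ _
  · rintro _ ⟨s, hs, rfl⟩
    rw [he] at hs
    obtain ⟨k, rfl⟩ := hs
    rw [tendsto_iff_dist_tendsto_zero]
    refine squeeze_zero' (Eventually.of_forall fun _ => dist_nonneg) ?_
      tendsto_one_div_add_atTop_nhds_zero_nat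
    filter_upwards [eventually_ge_atTop k] with n hn
    rw [Real.dist_eq]
    exact ((hp _ n ((hfin n).image f)).2 _
      (mem_image_of_mem f (mem_image_of_mem e hn))).le

/-- Vectors half-norming a countable dense set separate the points of `M`, so countably many
evaluations metrize the compact set `K`. -/
theorem isSeqCompact_of_subset_separable {K : Set (WeakDual ℝ V)} (hK : IsCompact K)
    {M : Submodule ℝ (StrongDual ℝ V)} (hM : IsSeparable (M : Set (StrongDual ℝ V)))
    (hKM : ∀ k ∈ K, WeakDual.toStrongDual k ∈ M) : IsSeqCompact K := by
  choose f hf using exists_half_norming (V := V)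
  obtain ⟨c, hc, hMc⟩ := hM
  have : Countable c := hc.to_subtype
  have hne : c.Nonempty := by
    rw [← closure_nonempty_iff]
    exact ⟨0, hMc M.zero_mem⟩
  obtain ⟨e, rfl⟩ := hc.exists_eq_range hne
  have : CompactSpace K := isCompact_iff_compactSpace.1 hK
  have : MetrizableSpace K :=
    Metric.PiNatEmbed.TopologicalSpace.MetrizableSpace.of_countable_separating
      (fun (n : ℕ) (k : K) => (k : WeakDual ℝ V) (f (e n)))
      (fun n => (WeakDual.eval_continuous (f (e n))).comp continuous_subtype_val) (by
        intro x y hxy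
        by_contra! h
        refine hxy (Subtype.ext ?_)
        have h0 := eq_zero_of_mem_closure_of_half_norming hf
          (hMc (M.sub_mem (hKM _ x.2) (hKM _ y.2))) (by
            rintro _ ⟨n, rfl⟩
            exact sub_eq_zero.2 (h n))
        exact sub_eq_zero.1 h0)
  have hc : SeqContinuous (fun k : K => (k : WeakDual ℝ V)) :=
    continuous_iff_seqContinuous.1 continuous_subtype_val
  simpa using IsSeqCompact.range hc

theorem WeakDual.exists_forall_norm_le [CompleteSpace V] {K : Set (WeakDual ℝ V)}
    (hK : IsCompact K) : ∃ C, ∀ k ∈ K, ‖WeakDual.toStrongDual k‖ ≤ C := by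
  obtain ⟨C, hC⟩ := banach_steinhaus (g := fun i : K => WeakDual.toStrongDual i.val) fun x => by
    obtain ⟨C, hC⟩ := hK.exists_bound_of_continuousOn (WeakDual.eval_continuous x).continuousOn
    exact ⟨C, fun i => hC i i.2⟩
  exact ⟨C, fun k hk => hC ⟨k, hk⟩⟩

theorem WeakDual.exists_forall_abs_le [CompleteSpace V] {K : Set (WeakDual ℝ V)}
    (hK : IsCompact K) (φ : StrongDual ℝ (StrongDual ℝ V)) :
    ∃ C, ∀ k ∈ K, |φ (WeakDual.toStrongDual k)| ≤ C := by
  obtain ⟨C, hC⟩ := WeakDual.exists_forall_norm_le hK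
  exact ⟨‖φ‖ * C, fun k hk => φ.le_of_opNorm_le_of_le le_rfl (hC k hk)⟩

end General

theorem isCompact_image_add {E W : Type*} [AddGroup E] [AddGroup W] [TopologicalSpace W]
    [ContinuousAdd W] (f : E →+ W) {K K' : Set E} (hK : IsCompact (f '' K))
    (hK' : IsCompact (f '' K')) : IsCompact (f '' (K + K')) := by
  rw [image_add]
  exact hK.add hK'

/-! ### Uniform approximation by evaluations. -/

section Approximation

variable {V : Type*} [NormedAddCommGroup V] [NormedSpace ℝ V]

theorem WeakDual.exists_eq_eval (f : StrongDual ℝ (WeakDual ℝ V)) :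
    ∃ v : V, ∀ k : WeakDual ℝ V, f k = k v := by
  obtain ⟨v, hv⟩ := LinearMap.dualEmbedding_surjective (topDualPairing ℝ V) f
  exact ⟨v, fun k => (DFunLike.congr_fun hv k).symm⟩

/-- A linear functional which is continuous on an absolutely convex compact set is uniformly
approximated there by continuous linear functionals. -/
theorem exists_strongDual_approx {W : Type*} [AddCommGroup W] [Module ℝ W] [TopologicalSpace W]
    [IsTopologicalAddGroup W] [ContinuousSMul ℝ W] [LocallyConvexSpace ℝ W] [T2Space W]
    {K : Set W} (hK : AbsConvex ℝ K) (hKc : IsCompact K) (φ : W →ₗ[ℝ] ℝ)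
    (hφ : ContinuousOn φ K) {ε : ℝ} (hε : 0 < ε) :
    ∃ g : StrongDual ℝ W, ∀ k ∈ K, |g k - φ k| ≤ ε := by
  rcases K.eq_empty_or_nonempty with rfl | hne
  · exact ⟨0, by simp⟩
  have h0 : (0 : W) ∈ K := hK.1.zero_mem hne
  let L : W →ₗ[ℝ] W × ℝ := LinearMap.id.prod φ
  have hG : IsCompact (L '' K) := hKc.image_of_continuousOn (continuousOn_id.prodMk hφ)
  have hGconv : Convex ℝ (L '' K) := hK.2.linear_image L
  -- Separate the graph of φ over `K` from its vertical translate by ε.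
  obtain ⟨f, u, v, hfu, huv, hvf⟩ := geometric_hahn_banach_compact_closed
    (s := L '' K) (t := (fun p => ((0, ε) : W × ℝ) + p) '' (L '' K))
    hGconv hG (hGconv.translate _)
    (hG.image (continuous_const.add continuous_id)).isClosed (by
      rw [disjoint_left]
      rintro _ ⟨k, -, rfl⟩ ⟨_, ⟨k', -, rfl⟩, h⟩
      have h1 : k' = k := by simpa [L] using congrArg Prod.fst h
      subst h1
      have h2 : ε + φ k' = φ k' := congrArg Prod.snd h
      linarith)
  let g : StrongDual ℝ W := f.comp (ContinuousLinearMap.inl ℝ W ℝ)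
  set s := f (0, 1)
  have hf : ∀ (k : W) (t : ℝ), f (k, t) = g k + t * s := by
    intro k t
    have h1 : ((k, t) : W × ℝ) = (k, 0) + t • (0, 1) := by simp
    rw [h1, map_add, map_smul, smul_eq_mul]
    rfl
  have hlt : ∀ k ∈ K, g k + φ k * s < u := fun k hk => by
    rw [← hf]
    exact hfu _ ⟨k, hk, rfl⟩
  have hv : v < ε * s := by
    have h1 : v < f ((0, ε) + L 0) := hvf _ ⟨_, ⟨0, h0, rfl⟩, rfl⟩
    have h2 : ((0, ε) : W × ℝ) + L 0 = (0, ε) := by simp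
    rw [h2, hf] at h1
    simpa using h1
  have hu : 0 < u := by simpa using hlt 0 h0
  -- The separating hyperplane is not vertical, so dividing by `s` turns it into the graph of a
  -- functional.
  have hspos : 0 < s := by
    have : 0 < ε * s := by linarith
    exact (pos_iff_pos_of_mul_pos this).1 hε
  have hle : ∀ k ∈ K, g k / s + φ k ≤ ε := fun k hk => by
    have h1 := hlt k hk
    rw [div_add' _ _ _ hspos.ne', div_le_iff₀ hspos]
    linarith
  have hg : ∀ k, (-(s⁻¹ • g)) k = -(g k / s) := fun k => by
    simp [div_eq_inv_mul]
  refine ⟨-(s⁻¹ • g), fun k hk => abs_le.2 ⟨?_, ?_⟩⟩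
  · have := hle k hk
    rw [hg]
    linarith
  -- The second bound follows from the first by the symmetry of `K`.
  · have := hle (-k) (hK.1.neg_mem_iff.2 hk)
    rw [map_neg, map_neg, neg_div] at this
    rw [hg]
    linarith

/-- A linear functional which is `w*`-continuous on an absolutely convex `w*`-compact set is
uniformly approximated there by evaluations. -/
theorem exists_eval_approx {K : Set (StrongDual ℝ V)} (hK : AbsConvex ℝ K)
    (hKc : IsCompact (StrongDual.toWeakDual '' K : Set (WeakDual ℝ V)))
    (φ : StrongDual ℝ V →ₗ[ℝ] ℝ)
    (hφ : ContinuousOn (fun k : WeakDual ℝ V => φ (WeakDual.toStrongDual k))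
      (StrongDual.toWeakDual '' K)) {ε : ℝ} (hε : 0 < ε) :
    ∃ v : V, ∀ k ∈ K, |k v - φ k| ≤ ε := by
  have : LocallyConvexSpace ℝ (WeakDual ℝ V) := (WeakDual.withSeminorms ℝ V).toLocallyConvexSpace
  have hK' : AbsConvex ℝ (StrongDual.toWeakDual '' K : Set (WeakDual ℝ V)) :=
    ⟨by
      rintro a ha _ ⟨_, ⟨k, hk, rfl⟩, rfl⟩
      exact ⟨a • k, hK.1 a ha ⟨k, hk, rfl⟩, map_smul _ a k⟩,
    hK.2.linear_image (StrongDual.toWeakDual (𝕜 := ℝ) (E := V)).toLinearMap⟩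
  let ψ : WeakDual ℝ V →ₗ[ℝ] ℝ := φ ∘ₗ WeakDual.toStrongDual.toLinearMap
  have hψ : ContinuousOn ψ (StrongDual.toWeakDual '' K) := hφ
  obtain ⟨g, hg⟩ := exists_strongDual_approx hK' hKc ψ hψ hε
  obtain ⟨v, hv⟩ := WeakDual.exists_eq_eval g
  refine ⟨v, fun k hk => ?_⟩
  have h1 := hg _ (mem_image_of_mem _ hk)
  rw [hv] at h1
  exact h1

end Approximation

/-! ### Using Mackey completeness. -/

section Completeness

variable {Z : Type*} [NormedAddCommGroup Z] [NormedSpace ℝ Z]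

theorem exists_mem_absConvexWeakStarCompacts {Y : Submodule ℝ (StrongDual ℝ Z)}
    {y : StrongDual ℝ Z} (hy : y ∈ Y) : ∃ K ∈ absConvexWeakStarCompacts Y, y ∈ K := by
  refine ⟨(LinearMap.toSpanSingleton ℝ _ y) '' Metric.closedBall 0 1, ⟨?_, ⟨?_, ?_⟩, ?_⟩,
    ⟨1, by simp, by simp⟩⟩
  · rintro _ ⟨t, -, rfl⟩
    exact Y.smul_mem t hy
  · rintro a ha _ ⟨_, ⟨t, ht, rfl⟩, rfl⟩
    refine ⟨a • t, ?_, by simp [mul_smul]⟩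
    rw [mem_closedBall_zero_iff] at ht ⊢
    rw [norm_smul]
    exact mul_le_one₀ ha (norm_nonneg _) ht
  · exact (convex_closedBall 0 1).linear_image _
  · rw [image_image]
    refine (isCompact_closedBall (0 : ℝ) 1).image ?_
    exact NormedSpace.Dual.toWeakDual_continuous.comp (continuous_id.smul continuous_const)

theorem zero_mem_of_mem_absConvexWeakStarCompacts {Y : Submodule ℝ (StrongDual ℝ Z)}
    {K : Set (StrongDual ℝ Z)} (hK : K ∈ absConvexWeakStarCompacts Y) (hne : K.Nonempty) :
    0 ∈ K := by
  obtain ⟨k, hk⟩ := hne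
  have h : (0 : ℝ) • k ∈ K := hK.2.1.1 0 (by simp) ⟨k, hk, rfl⟩
  rwa [zero_smul] at h

/-- Nonempty members contain 0, so `K + K'` contains both. -/
theorem directedOn_absConvexWeakStarCompacts (Y : Submodule ℝ (StrongDual ℝ Z)) :
    DirectedOn (· ⊆ ·) (absConvexWeakStarCompacts Y) := by
  intro K hK K' hK'
  rcases K.eq_empty_or_nonempty with rfl | hne
  · exact ⟨K', hK', empty_subset _, Subset.rfl⟩
  rcases K'.eq_empty_or_nonempty with rfl | hne'
  · exact ⟨K, hK, Subset.rfl, empty_subset _⟩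
  have hc : IsCompact (StrongDual.toWeakDual '' (K + K') : Set (WeakDual ℝ Z)) :=
    isCompact_image_add
      (StrongDual.toWeakDual (𝕜 := ℝ) (E := Z)).toLinearMap.toAddMonoidHom hK.2.2 hK'.2.2
  have hac : AbsConvex ℝ (K + K') := ⟨hK.2.1.1.add hK'.2.1.1, hK.2.1.2.add hK'.2.1.2⟩
  have hY : K + K' ⊆ Y := by
    rintro _ ⟨k, hk, k', hk', rfl⟩
    exact Y.add_mem (hK.1 hk) (hK'.1 hk')
  refine ⟨K + K', ⟨hY, hac, hc⟩, ?_, ?_⟩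
  · exact fun k hk => ⟨k, hk, 0, zero_mem_of_mem_absConvexWeakStarCompacts hK' hne', add_zero k⟩
  · exact fun k hk => ⟨0, zero_mem_of_mem_absConvexWeakStarCompacts hK hne, k, hk, zero_add k⟩

/-- In a Mackey complete space, functionals on `Y` which are approximated by evaluations on the
absolutely convex `w*`-compact subsets of `Y` are evaluations. -/
theorem MackeyComplete.exists_eval {Y : Submodule ℝ (StrongDual ℝ Z)} (hY : MackeyComplete Y)
    (φ : StrongDual ℝ Z → ℝ)
    (h : ∀ K ∈ absConvexWeakStarCompacts Y, ∀ ε > 0, ∃ x : Z, ∀ k ∈ K, |k x - φ k| ≤ ε) :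
    ∃ x : Z, ∀ y ∈ Y, y x = φ y := by
  let i : Z → (StrongDual ℝ Z →ᵤ[absConvexWeakStarCompacts Y] ℝ) := fun x =>
    UniformOnFun.ofFun _ fun f => f x
  let Φ : StrongDual ℝ Z →ᵤ[absConvexWeakStarCompacts Y] ℝ := UniformOnFun.ofFun _ φ
  let _ : UniformSpace Z := mackeyUniformSpace Y
  have : CompleteSpace Z := hY
  -- The approximation hypothesis says that φ is in the closure of the evaluations, so
  -- neighbourhoods of φ pull back to a Cauchy filter on `Z`.
  have hne : (comap i (𝓝 Φ)).NeBot := by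
    obtain ⟨K₀, hK₀, -⟩ := exists_mem_absConvexWeakStarCompacts Y.zero_mem
    rw [((UniformOnFun.hasBasis_nhds_of_basis _ _ _ Φ ⟨K₀, hK₀⟩
      (directedOn_absConvexWeakStarCompacts Y) Metric.uniformity_basis_dist_le).comap i).neBot_iff]
    rintro ⟨K, ε⟩ ⟨hK, hε⟩
    obtain ⟨x, hx⟩ := h K hK ε hε
    exact ⟨x, fun k hk => hx k hk⟩
  have hc : Cauchy (comap i (𝓝 Φ)) := (cauchy_nhds (a := Φ)).comap le_rfl
  obtain ⟨x, hx⟩ := CompleteSpace.complete hc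
  refine ⟨x, fun y hy => ?_⟩
  obtain ⟨K, hK, hyK⟩ := exists_mem_absConvexWeakStarCompacts hy
  have hev := (UniformOnFun.uniformContinuous_eval_of_mem ℝ _ hyK hK).continuous
  have hi : Continuous i := (uniformContinuous_comap (f := i)).continuous
  have h1 := (hev.tendsto (i x)).comp ((hi.tendsto x).mono_left hx)
  have h2 := (hev.tendsto Φ).comp (tendsto_comap (f := i) (x := 𝓝 Φ))
  exact tendsto_nhds_unique h1 h2

end Completeness

/-! ### The subspace X ⊕ ℝξ of the bidual. -/

section Bidual

theorem exists_dual_ne_zero_of_notMem {E : Type*} [NormedAddCommGroup E] [NormedSpace ℝ E]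
    {p : Submodule ℝ E} (hp : IsClosed (p : Set E)) {x : E} (hx : x ∉ p) :
    ∃ f : StrongDual ℝ E, f x ≠ 0 ∧ ∀ y ∈ p, f y = 0 := by
  obtain ⟨f, c, hfx, hf⟩ := geometric_hahn_banach_point_closed p.convex hp hx
  have hc : c < 0 := by simpa using hf 0 p.zero_mem
  refine ⟨f, (hfx.trans hc).ne, fun y hy => ?_⟩
  by_contra h
  have := hf _ (p.smul_mem (c / f y) hy)
  rw [map_smul, smul_eq_mul, div_mul_cancel₀ _ h] at this
  exact lt_irrefl _ this

theorem StrongDual.map_sub_smul {E : Type*} [NormedAddCommGroup E] [NormedSpace ℝ E]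
    (φ : StrongDual ℝ E) (x y : E) (c : ℝ) : φ (x - c • y) = φ x - c * φ y := by
  rw [map_sub, map_smul, smul_eq_mul]

theorem sub_smul_sub_sub_smul {E : Type*} [AddCommGroup E] [Module ℝ E] (x y : E) (a b : ℝ) :
    x - b • y - (a - b) • y = x - a • y := by
  rw [sub_smul]
  abel

/-- When φ kills `p` and φ(ξ) = 1, this `Y` is p ⊕ ℝξ; as a preimage of `p` it is visibly closed. -/
theorem exists_isClosed_submodule_mem_iff {E : Type*} [NormedAddCommGroup E] [NormedSpace ℝ E]
    {p : Submodule ℝ E} (hp : IsClosed (p : Set E)) (φ : StrongDual ℝ E) (ξ : E) :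
    ∃ Y : Submodule ℝ E, IsClosed (Y : Set E) ∧ ∀ y, y ∈ Y ↔ y - φ y • ξ ∈ p := by
  let P : E →L[ℝ] E := ContinuousLinearMap.id ℝ E - φ.smulRight ξ
  exact ⟨p.comap P.toLinearMap, hp.preimage P.continuous, fun y => Iff.rfl⟩

variable {X : Type*} [NormedAddCommGroup X] [NormedSpace ℝ X]

theorem isClosed_range_inclusionInDoubleDual [CompleteSpace X] :
    IsClosed ((inclusionInDoubleDual ℝ X).range : Set (StrongDual ℝ (StrongDual ℝ X))) := by
  have h := (inclusionInDoubleDualLi (E := X) ℝ).isometry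
  exact h.isUniformInducing.isComplete_range.isClosed

/-- If `ξ` is not a `w*`-limit of a sequence in `X`, then in a `w*`-compact subset of `X ⊕ ℝξ` the
`w*`-closure of every set of elements of `X` stays in `X`. -/
theorem exists_eq_inclusion_of_mem_closure {ξ : StrongDual ℝ (StrongDual ℝ X)}
    {φ : StrongDual ℝ (StrongDual ℝ X) →ₗ[ℝ] ℝ}
    (hξ : StrongDual.toWeakDual ξ ∉ seqClosure (range fun x : X =>
      StrongDual.toWeakDual (inclusionInDoubleDual ℝ X x)))
    {B : Set (WeakDual ℝ (StrongDual ℝ X))} (hB : IsCompact B)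
    (hBφ : ∀ b ∈ B, ∃ x, WeakDual.toStrongDual b - φ (WeakDual.toStrongDual b) • ξ =
      inclusionInDoubleDual ℝ X x)
    {A : Set (WeakDual ℝ (StrongDual ℝ X))} (hAB : A ⊆ B)
    (hA : ∀ a ∈ A, ∃ x, WeakDual.toStrongDual a = inclusionInDoubleDual ℝ X x)
    {z : WeakDual ℝ (StrongDual ℝ X)} (hz : z ∈ closure A) :
    ∃ x, WeakDual.toStrongDual z = inclusionInDoubleDual ℝ X x := by
  by_contra hzX
  obtain ⟨M, D, a, hMc, hMs, hzM, hD, ha, had⟩ := exists_seq_tendsto_on_separating hz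
  choose x hx using fun n => hA (a n) (ha n).1
  let p : Submodule ℝ X := M.comap (inclusionInDoubleDual ℝ X).toLinearMap
  have hp : IsClosed (p : Set X) := hMc.preimage (inclusionInDoubleDual ℝ X).continuous
  have hxp : ∀ n, x n ∈ p := fun n => by
    change inclusionInDoubleDual ℝ X (x n) ∈ M
    rw [← hx]; exact (ha n).2
  -- Hahn–Banach in X: what is killed by the annihilator of `p` = M ∩ X lies in `p`.
  have hmem : ∀ u : X, (∀ f : StrongDual ℝ X, (∀ e ∈ p, f e = 0) → f u = 0) →
      inclusionInDoubleDual ℝ X u ∈ M := by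
    intro u hu
    by_contra h
    obtain ⟨f, hf, hfp⟩ := exists_dual_ne_zero_of_notMem hp (show u ∉ p from h)
    exact hf (hu f hfp)
  have haB : range a ⊆ B := range_subset_iff.2 fun n => hAB (ha n).1
  have hclB : closure (range a) ⊆ B := closure_minimal haB hB.isClosed
  have hann : ∀ y ∈ closure (range a), ∀ f : StrongDual ℝ X, (∀ e ∈ p, f e = 0) → y f = 0 := by
    intro y hy f hf
    refine closure_minimal (t := {y : WeakDual ℝ (StrongDual ℝ X) | y f = 0}) ?_
      (isClosed_eq (WeakDual.eval_continuous f) continuous_const) hy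
    rintro _ ⟨n, rfl⟩
    have : a n f = inclusionInDoubleDual ℝ X (x n) f := DFunLike.congr_fun (hx n) f
    exact this.trans (hf _ (hxp n))
  -- A limit with zero ξ-coordinate is in X, hence in `M`; it agrees with `z` on `D`, so it equals
  -- `z`, which is not in X.
  have hlim : ∀ (l : Filter ℕ) [l.NeBot], l ≤ atTop → ∀ y ∈ closure (range a),
      Tendsto a l (𝓝 y) → φ (WeakDual.toStrongDual y) ≠ 0 := by
    intro l _ hl y hy hlim h0
    obtain ⟨u, hu⟩ := hBφ y (hclB hy)
    replace hu : WeakDual.toStrongDual y = inclusionInDoubleDual ℝ X u := by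
      rw [← hu, h0, zero_smul]
      exact (sub_zero _).symm
    have hyM : WeakDual.toStrongDual y ∈ M := by
      rw [hu]
      refine hmem u fun f hf => ?_
      have : y f = inclusionInDoubleDual ℝ X u f := DFunLike.congr_fun hu f
      exact this.symm.trans (hann y hy f hf)
    have hyz := hD _ (M.sub_mem hyM hzM) fun d hd => sub_eq_zero.2 <|
      tendsto_nhds_unique (((WeakDual.eval_continuous d).tendsto y).comp hlim)
        ((had d hd).mono_left hl)
    exact hzX ⟨u, by rw [← sub_eq_zero.1 hyz, hu]⟩
  have hcl : IsCompact (closure (range a)) := hB.of_isClosed_subset isClosed_closure hclB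
  obtain ⟨y₀, hy₀, hUy₀⟩ := hcl.ultrafilter_le_nhds ((hyperfilter ℕ).map a)
    (le_principal_iff.2 (Ultrafilter.mem_map.2
      (univ_mem' fun n => subset_closure (mem_range_self n))))
  have hφ₀ := hlim (hyperfilter ℕ) Nat.hyperfilter_le_atTop y₀ hy₀ hUy₀
  obtain ⟨u₀, hu₀⟩ := hBφ y₀ (hclB hy₀)
  -- One cluster point off X suffices: subtracting a multiple of `y₀` kills the ξ-coordinate, and
  -- the remainder lies in `M`.
  let M' : Submodule ℝ (StrongDual ℝ (StrongDual ℝ X)) :=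
    Submodule.span ℝ ((M : Set _) ∪ {WeakDual.toStrongDual y₀})
  have hM's : IsSeparable (M' : Set (StrongDual ℝ (StrongDual ℝ X))) :=
    (hMs.union (countable_singleton _).isSeparable).span
  have hKM' : ∀ k ∈ closure (range a), WeakDual.toStrongDual k ∈ M' := by
    intro k hk
    obtain ⟨u, hu⟩ := hBφ k (hclB hk)
    set c := φ (WeakDual.toStrongDual k) / φ (WeakDual.toStrongDual y₀) with hc
    have h1 : WeakDual.toStrongDual k - c • WeakDual.toStrongDual y₀ =
        inclusionInDoubleDual ℝ X (u - c • u₀) := by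
      rw [map_sub, map_smul, ← hu, ← hu₀, smul_sub, smul_smul, hc, div_mul_cancel₀ _ hφ₀]
      abel
    have h2 : WeakDual.toStrongDual k - c • WeakDual.toStrongDual y₀ ∈ M := by
      rw [h1]
      refine hmem _ fun f hf => ?_
      have h3 : k f - c * y₀ f = f (u - c • u₀) := DFunLike.congr_fun h1 f
      rw [← h3, hann k hk f hf, hann y₀ hy₀ f hf, mul_zero, sub_zero]
    rw [← sub_add_cancel (WeakDual.toStrongDual k) (c • WeakDual.toStrongDual y₀)]
    exact M'.add_mem (Submodule.subset_span (Or.inl h2))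
      (M'.smul_mem c (Submodule.subset_span (Or.inr rfl)))
  obtain ⟨y₁, hy₁, θ, hθ, hlim₁⟩ :=
    isSeqCompact_of_subset_separable hcl hM's hKM' fun n => subset_closure (mem_range_self n)
  have hφ₁ := hlim (map θ atTop) hθ.tendsto_atTop y₁ hy₁ (tendsto_map'_iff.2 hlim₁)
  obtain ⟨u₁, hu₁⟩ := hBφ y₁ (hclB hy₁)
  set t := φ (WeakDual.toStrongDual y₁)
  -- Since y₁ = u₁ + tξ with t ≠ 0, solving for ξ exhibits it as a limit of a sequence from X.
  refine hξ ⟨fun n => t⁻¹ • (a (θ n) - StrongDual.toWeakDual (inclusionInDoubleDual ℝ X u₁)),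
    fun n => ⟨t⁻¹ • (x (θ n) - u₁), ?_⟩, ?_⟩
  · simp only [map_smul, map_sub, ← hx, WeakDual.toWeakDual_toStrongDual]
  · have h1 : StrongDual.toWeakDual ξ =
        t⁻¹ • (y₁ - StrongDual.toWeakDual (inclusionInDoubleDual ℝ X u₁)) := by
      rw [← hu₁, map_sub, map_smul, WeakDual.toWeakDual_toStrongDual, sub_sub_cancel, smul_smul,
        inv_mul_cancel₀ hφ₁, one_smul]
    rw [h1]
    exact (hlim₁.sub_const _).const_smul _

/-- If `ξ` is not a `w*`-limit of a sequence in `X`, then the projection of `X ⊕ ℝξ` onto the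
coordinate at `ξ` is `w*`-continuous on `w*`-compact sets. -/
theorem continuousOn_of_notMem_seqClosure {ξ : StrongDual ℝ (StrongDual ℝ X)}
    {φ : StrongDual ℝ (StrongDual ℝ (StrongDual ℝ X))}
    (hφX : ∀ x : X, φ (inclusionInDoubleDual ℝ X x) = 0) (hφξ : φ ξ = 1)
    (hξ : StrongDual.toWeakDual ξ ∉ seqClosure (range fun x : X =>
      StrongDual.toWeakDual (inclusionInDoubleDual ℝ X x)))
    {K : Set (WeakDual ℝ (StrongDual ℝ X))} (hK : IsCompact K)
    (hKφ : ∀ k ∈ K, ∃ x, WeakDual.toStrongDual k - φ (WeakDual.toStrongDual k) • ξ =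
      inclusionInDoubleDual ℝ X x) :
    ContinuousOn (fun k : WeakDual ℝ (StrongDual ℝ X) => φ (WeakDual.toStrongDual k)) K := by
  have hsub : ∀ (w : StrongDual ℝ (StrongDual ℝ X)) (c : ℝ), φ (w - c • ξ) = φ w - c :=
    fun w c => (StrongDual.map_sub_smul φ w ξ c).trans (by rw [hφξ, mul_one])
  obtain ⟨C, hC⟩ := WeakDual.exists_forall_abs_le hK φ
  have hbd : ∀ k ∈ K, φ (WeakDual.toStrongDual k) ∈ Metric.closedBall (0 : ℝ) (C) :=
    fun k hk => mem_closedBall_zero_iff.2 (hC k hk)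
  -- If φ tends to c along an ultrafilter converging to k, the X-components k' - φ(k')ξ tend to k -
  -- cξ inside a compact set; this limit is in X, so c = φ(k).
  let g : WeakDual ℝ (StrongDual ℝ X) × ℝ → WeakDual ℝ (StrongDual ℝ X) := fun q =>
    q.1 - q.2 • StrongDual.toWeakDual ξ
  have hg : Continuous g :=
    continuous_fst.sub (continuous_snd.smul (continuous_const (y := StrongDual.toWeakDual ξ)))
  have hB : IsCompact (g '' (K ×ˢ Metric.closedBall (0 : ℝ) (C))) :=
    (hK.prod (isCompact_closedBall _ _)).image hg
  intro k hk
  refine (tendsto_iff_ultrafilter _ _ _).2 fun U hU => ?_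
  have hUK : K ∈ U := hU self_mem_nhdsWithin
  obtain ⟨c, hc, hUc⟩ := (isCompact_closedBall (0 : ℝ) (C)).ultrafilter_le_nhds
    (U.map fun k => φ (WeakDual.toStrongDual k))
    (le_principal_iff.2 (Ultrafilter.mem_map.2 (mem_of_superset hUK hbd)))
  have hlim : Tendsto (fun k => g (k, φ (WeakDual.toStrongDual k))) U (𝓝 (g (k, c))) :=
    have hUk : Tendsto id (U : Filter (WeakDual ℝ (StrongDual ℝ X))) (𝓝 k) :=
      hU.trans nhdsWithin_le_nhds
    have hUc' : Tendsto (fun k => φ (WeakDual.toStrongDual k)) U (𝓝 c) := hUc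
    (hg.tendsto (k, c)).comp (hUk.prodMk_nhds hUc')
  have hBφ : ∀ b ∈ g '' (K ×ˢ Metric.closedBall (0 : ℝ) C), ∃ x, WeakDual.toStrongDual b -
      φ (WeakDual.toStrongDual b) • ξ = inclusionInDoubleDual ℝ X x := by
    rintro _ ⟨⟨b, s⟩, ⟨hb, -⟩, rfl⟩
    obtain ⟨x, hx⟩ := hKφ b hb
    refine ⟨x, ?_⟩
    change WeakDual.toStrongDual b - s • ξ - φ (WeakDual.toStrongDual b - s • ξ) • ξ = _
    rw [← hx, hsub]
    exact sub_smul_sub_sub_smul _ ξ _ s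
  have hAB : (fun k => g (k, φ (WeakDual.toStrongDual k))) '' K ⊆
      g '' (K ×ˢ Metric.closedBall (0 : ℝ) C) := by
    rintro _ ⟨b, hb, rfl⟩
    exact ⟨(b, _), ⟨hb, hbd b hb⟩, rfl⟩
  have hA : ∀ a ∈ (fun k => g (k, φ (WeakDual.toStrongDual k))) '' K,
      ∃ x, WeakDual.toStrongDual a = inclusionInDoubleDual ℝ X x := by
    rintro _ ⟨b, hb, rfl⟩
    exact hKφ b hb
  obtain ⟨x, hx⟩ := exists_eq_inclusion_of_mem_closure (φ := φ.toLinearMap) hξ hB hBφ hAB hA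
    (mem_closure_of_tendsto hlim (mem_of_superset hUK fun k hk => mem_image_of_mem _ hk))
  have h1 : φ (WeakDual.toStrongDual k - c • ξ) = 0 := (congrArg φ hx).trans (hφX x)
  rw [hsub, sub_eq_zero] at h1
  change (U.map fun k => φ (WeakDual.toStrongDual k) : Filter ℝ) ≤ 𝓝 (φ (WeakDual.toStrongDual k))
  rw [h1]
  exact hUc

/-- The unit ball of X already computes the norm of X*, so both constants are 1. -/
theorem isNorming_of_range_le {Y : Submodule ℝ (StrongDual ℝ (StrongDual ℝ X))}
    (hY : (inclusionInDoubleDual ℝ X).range ≤ Y) : IsNorming Y := by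
  refine ⟨1, one_pos, 1, one_pos, fun f => ?_⟩
  rw [one_mul]
  constructor
  · refine le_of_forall_lt fun r hr => ?_
    obtain ⟨x, hx, hfx⟩ := f.exists_lt_apply_of_lt_opNorm hr
    have hle : ∀ x : X, ‖x‖ < 1 → f x ≤ supNorm Y f := fun x hx =>
      le_csSup (bddAbove_supNorm Y f) ⟨inclusionInDoubleDual ℝ X x, hY ⟨x, rfl⟩,
        (double_dual_bound ℝ X x).trans hx.le, rfl⟩
    refine hfx.trans_le (abs_le'.2 ⟨hle x hx, ?_⟩)
    rw [← map_neg]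
    exact hle (-x) (by rwa [norm_neg])
  · refine csSup_le ⟨0, 0, Y.zero_mem, by simp, by simp⟩ ?_
    rintro r ⟨F, -, hF, rfl⟩
    exact (le_abs_self _).trans ((F.le_of_opNorm_le hF f).trans_eq (one_mul _))

end Bidual

end FullyMackey

open FullyMackey NormedSpace Set in
theorem mainTheorem7 {X : Type*} [NormedAddCommGroup X] [NormedSpace ℝ X] [CompleteSpace X]
    (h : FullyMackey.FullyMackeyComplete (StrongDual ℝ X)) :
    FullyMackey.WeakStarSeqDenseInBidual X := by
  refine eq_univ_of_forall fun ξ' => ?_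
  by_contra hξ
  obtain ⟨ξ, rfl⟩ := StrongDual.toWeakDual.surjective ξ'
  have hξX : ξ ∉ (inclusionInDoubleDual ℝ X).range := by
    rintro ⟨x, rfl⟩
    exact hξ (subset_seqClosure ⟨x, rfl⟩)
  obtain ⟨ψ, hψξ, hψX⟩ := exists_dual_ne_zero_of_notMem
    (E := StrongDual ℝ (StrongDual ℝ X)) (p := (inclusionInDoubleDual ℝ X).range)
    isClosed_range_inclusionInDoubleDual hξX
  let φ : StrongDual ℝ (StrongDual ℝ (StrongDual ℝ X)) := (ψ ξ)⁻¹ • ψ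
  have hφξ : φ ξ = 1 := inv_mul_cancel₀ hψξ
  have hφX : ∀ x : X, φ (inclusionInDoubleDual ℝ X x) = 0 := fun x =>
    mul_eq_zero_of_right _ (hψX _ ⟨x, rfl⟩)
  obtain ⟨Y, hYc, hY⟩ := exists_isClosed_submodule_mem_iff
    (E := StrongDual ℝ (StrongDual ℝ X)) (p := (inclusionInDoubleDual ℝ X).range)
    isClosed_range_inclusionInDoubleDual φ ξ
  have hYX : (inclusionInDoubleDual ℝ X).range ≤ Y := by
    rintro _ ⟨x, rfl⟩
    refine (hY _).2 ⟨x, ?_⟩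
    change _ = inclusionInDoubleDual ℝ X x - φ (inclusionInDoubleDual ℝ X x) • ξ
    rw [hφX, zero_smul]
    exact (sub_zero _).symm
  have hYξ : ξ ∈ Y := by
    rw [hY, hφξ, one_smul]
    exact ⟨0, by rw [map_zero]; exact (sub_self ξ).symm⟩
  have hYφ : ∀ y ∈ Y, ∃ x, y - φ y • ξ = inclusionInDoubleDual ℝ X x := fun y hy =>
    let ⟨x, hx⟩ := (hY y).1 hy
    ⟨x, hx.symm⟩
  obtain ⟨f, hf⟩ := (h Y (isNorming_of_range_le hYX) hYc).exists_eval φ fun K hK ε hε =>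
    exists_eval_approx hK.2.1 hK.2.2 φ.toLinearMap
      (continuousOn_of_notMem_seqClosure hφX hφξ hξ hK.2.2 (by
        rintro _ ⟨k, hk, rfl⟩
        exact hYφ k (hK.1 hk))) hε
  have hf0 : f = 0 := by
    ext x
    have := hf _ (hYX ⟨x, rfl⟩)
    exact this.trans (hφX x)
  have h1 := hf ξ hYξ
  rw [hf0, map_zero, hφξ] at h1
  exact zero_ne_one h1
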